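/- Let $X$ be a compact connected (Hausdorff) complex manifold of dimension $k$. A holomorphic correspondence $F$ on $X$ is a formal sum $\Gamma=\sum_{j=1}^N m_j\Gamma_j$ with $N\ge 1$, where the $m_j$ are positive integers and the $\Gamma_j$ are distinct irreducible analytic subvarieties of $X\times X$ of dimension $k$, such that both coordinate projections $\pi_1,\pi_2$ map each $\Gamma_j$ onto $X$, and such that for every $z\in X$ the sets $\{w:(z,w)\in\bigcup_j\Gamma_j\}$ and $F^\dagger(z):=\{w:(w,z)\in\bigcup_j\Gamma_j\}$ are finite. The multiplicity of $w\in F^\dagger(z)$ is $\sum_j m_j\nu_j(w,z)$, where $\nu_j(w,z)$ is the local multiplicity of $\pi_2|_{\Gamma_j}$ at $(w,z)$, i.e. the number of points $w'$ near $w$ with $(w',z')\in\Gamma_j$ for a generic $z'$ near $z$ (and $\nu_j(w,z)=0$ if $(w,z)\notin\Gamma_j$); $\sum'_{w\in F^\dagger(z)}$ denotes the sum over $F^\dagger(z)$ in which each point is repeated according to its multiplicity. The topological degree $d$ of $F$ is the number of points of $F^\dagger(z)$, counted with multiplicity, for generic $z$, that is, for $z$ outside a proper analytic subset of $X$ over whose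 complement every $\pi_2|_{\Gamma_j}$ is an unramified covering. Let $\mu$ be a Borel probability measure on $X$ that is $F^*$-invariant, i.e. $$\int_X \sideset{}{'}\sum_{w\in F^\dagger(z)}\varphi(w)\,d\mu(z)=d\int_X\varphi\,d\mu\qquad\text{for every continuous }\varphi:X\to\mathbb R .$$ Then for every $1\le q<\infty$ the Koopman operator $$(U_F\varphi)(z)=\frac1d\sideset{}{'}\sum_{w\in F^\dagger(z)}\varphi(w)$$ is a well-defined bounded linear operator $U_F:L^q(\mu)\to L^q(\mu)$ (for real- or complex-valued functions; the class of $U_F\varphi$ does not depend on the representative of $\varphi$), and it is a contraction: $\|U_F\varphi\|_q\le\|\varphi\|_q$ for all $\varphi\in L^q(\mu)$. -/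

import Mathlib

open scoped Manifold ContDiff Topology ENNReal
open MeasureTheory

/-! ### Analytic subsets of complex manifolds -/

/-- `A` is a (closed) analytic subset of the complex manifold `M`: around every point of `M` it is
the common zero set of finitely many holomorphic functions. -/
def IsAnalyticSubset {E H M : Type*} [NormedAddCommGroup E] [NormedSpace ℂ E] [TopologicalSpace H]
    [TopologicalSpace M] [ChartedSpace H M] (I : ModelWithCorners ℂ E H) (A : Set M) : Prop :=
  ∀ x : M, ∃ U : Set M, IsOpen U ∧ x ∈ U ∧ ∃ (n : ℕ) (f : M → (Fin n → ℂ)),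
    MDifferentiableOn I 𝓘(ℂ, Fin n → ℂ) f U ∧ A ∩ U = {y | y ∈ U ∧ f y = 0}

/-- `x` is a regular point of dimension `l` of `A`: near `x`, the set `A` is a complex submanifold
of dimension `l`, namely the zero set of a holomorphic submersion to `ℂ ^ c`, where
`l + c` is the dimension of the ambient manifold. -/
def IsRegularPointOfDim {E H M : Type*} [NormedAddCommGroup E] [NormedSpace ℂ E]
    [TopologicalSpace H] [TopologicalSpace M] [ChartedSpace H M] (I : ModelWithCorners ℂ E H)
    (A : Set M) (l : ℕ) (x : M) : Prop :=
  x ∈ A ∧ ∃ U : Set M, IsOpen U ∧ x ∈ U ∧ ∃ (c : ℕ) (f : M → (Fin c → ℂ)),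
    l + c = Module.finrank ℂ E ∧ MDifferentiableOn I 𝓘(ℂ, Fin c → ℂ) f U ∧
      A ∩ U = {y | y ∈ U ∧ f y = 0} ∧ Function.Surjective (mfderiv I 𝓘(ℂ, Fin c → ℂ) f x)

/-- `A` is an irreducible analytic subset: analytic, nonempty, and not the union of two analytic
subsets that are both different from `A`. -/
def IsIrreducibleAnalytic {E H M : Type*} [NormedAddCommGroup E] [NormedSpace ℂ E]
    [TopologicalSpace H] [TopologicalSpace M] [ChartedSpace H M] (I : ModelWithCorners ℂ E H)
    (A : Set M) : Prop :=
  IsAnalyticSubset I A ∧ A.Nonempty ∧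
    ∀ A₁ A₂ : Set M, IsAnalyticSubset I A₁ → IsAnalyticSubset I A₂ → A = A₁ ∪ A₂ →
      A = A₁ ∨ A = A₂

/-- The analytic set `A` has dimension `k`: this is the largest dimension of `A` at a regular
point. -/
def HasAnalyticDim {E H M : Type*} [NormedAddCommGroup E] [NormedSpace ℂ E]
    [TopologicalSpace H] [TopologicalSpace M] [ChartedSpace H M] (I : ModelWithCorners ℂ E H)
    (A : Set M) (k : ℕ) : Prop :=
  IsGreatest {l : ℕ | ∃ x, IsRegularPointOfDim I A l x} k

/-! ### Holomorphic correspondences -/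

/-- A holomorphic correspondence `∑ j, m j • Γ j` on a complex manifold `X` of dimension `k`. -/
structure HolomorphicCorrespondence (k : ℕ) (X : Type*) [TopologicalSpace X]
    [ChartedSpace (EuclideanSpace ℂ (Fin k)) X] where
  /-- the number of components -/
  N : ℕ
  N_pos : 0 < N
  /-- the multiplicities of the components -/
  m : Fin N → ℕ
  m_pos : ∀ j, 0 < m j
  /-- the components -/
  Γ : Fin N → Set (X × X)
  distinct : Function.Injective Γ
  irreducible : ∀ j, IsIrreducibleAnalytic
    (𝓘(ℂ, EuclideanSpace ℂ (Fin k)).prod 𝓘(ℂ, EuclideanSpace ℂ (Fin k))) (Γ j)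
  dim : ∀ j, HasAnalyticDim
    (𝓘(ℂ, EuclideanSpace ℂ (Fin k)).prod 𝓘(ℂ, EuclideanSpace ℂ (Fin k))) (Γ j) k
  surjective_fst : ∀ j, Prod.fst '' Γ j = Set.univ
  surjective_snd : ∀ j, Prod.snd '' Γ j = Set.univ
  finite_image : ∀ z : X, {w | ∃ j, (z, w) ∈ Γ j}.Finite
  finite_preimage : ∀ z : X, {w | ∃ j, (w, z) ∈ Γ j}.Finite

namespace HolomorphicCorrespondence

/-- The set `F†(z)` of preimages of `z`, without multiplicities, as a finite set. -/
noncomputable def preimage {k : ℕ} {X : Type*} [TopologicalSpace X]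
    [ChartedSpace (EuclideanSpace ℂ (Fin k)) X] (F : HolomorphicCorrespondence k X) (z : X) :
    Finset X :=
  (F.finite_preimage z).toFinset

/-- The points of `X` over which the second projection `Γ j → X` is an unramified covering. -/
def unramifiedLocus {k : ℕ} {X : Type*} [TopologicalSpace X]
    [ChartedSpace (EuclideanSpace ℂ (Fin k)) X] (F : HolomorphicCorrespondence k X)
    (j : Fin F.N) : Set X :=
  {z | IsEvenlyCovered (fun p : F.Γ j => p.1.2) z ((fun p : F.Γ j => p.1.2) ⁻¹' {z})}

/-- The local multiplicity at `(w, z)` of the second projection `Γ j → X`: the number of preimages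
close to `w` of a generic point close to `z`. It is the least `n` such that some neighbourhood of
`w` contains at most `n` of the preimages of each unramified point close to `z`. -/
noncomputable def localMult {k : ℕ} {X : Type*} [TopologicalSpace X]
    [ChartedSpace (EuclideanSpace ℂ (Fin k)) X] (F : HolomorphicCorrespondence k X)
    (j : Fin F.N) (w z : X) : ℕ :=
  sInf {n : ℕ | ∃ V ∈ 𝓝 w, ∀ᶠ z' in 𝓝[F.unramifiedLocus j] z,
    {w' | w' ∈ V ∧ (w', z') ∈ F.Γ j}.ncard ≤ n}

/-- The multiplicity of `w` as a preimage of `z` under the correspondence `∑ j, m j • Γ j`. -/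
noncomputable def mult {k : ℕ} {X : Type*} [TopologicalSpace X]
    [ChartedSpace (EuclideanSpace ℂ (Fin k)) X] (F : HolomorphicCorrespondence k X)
    (w z : X) : ℕ :=
  ∑ j, F.m j * F.localMult j w z

/-- The sum of the values of `φ` over the preimages of `z`, repeated according to multiplicity. -/
noncomputable def sumPreimages {k : ℕ} {X : Type*} [TopologicalSpace X]
    [ChartedSpace (EuclideanSpace ℂ (Fin k)) X] (F : HolomorphicCorrespondence k X)
    {V : Type*} [AddCommMonoid V] (φ : X → V) (z : X) : V :=
  ∑ w ∈ F.preimage z, F.mult w z • φ w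

/-- `d` is the topological degree of `F`: outside a proper analytic subset of `X`, every point is
unramified for each component, and its preimages, each counted `m j` times for every component
`Γ j`, are `d` in number. -/
def IsTopologicalDegree {k : ℕ} {X : Type*} [TopologicalSpace X]
    [ChartedSpace (EuclideanSpace ℂ (Fin k)) X] (F : HolomorphicCorrespondence k X)
    (d : ℕ) : Prop :=
  ∃ A : Set X, IsAnalyticSubset 𝓘(ℂ, EuclideanSpace ℂ (Fin k)) A ∧ A ≠ Set.univ ∧
    ∀ z, z ∉ A → (∀ j, z ∈ F.unramifiedLocus j) ∧ ∑ j, F.m j * {w | (w, z) ∈ F.Γ j}.ncard = d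

/-- The pull-back `F^* μ`, as a functional on continuous functions. -/
noncomputable def pullback {k : ℕ} {X : Type*} [TopologicalSpace X]
    [ChartedSpace (EuclideanSpace ℂ (Fin k)) X] [MeasurableSpace X]
    (F : HolomorphicCorrespondence k X) (μ : Measure X) (φ : C(X, ℝ)) : ℝ :=
  ∫ z, F.sumPreimages φ z ∂μ

/-- `μ` is `F^*`-invariant: `F^* μ = d μ`, where `d` is the topological degree of `F`. -/
def IsInvariant {k : ℕ} {X : Type*} [TopologicalSpace X]
    [ChartedSpace (EuclideanSpace ℂ (Fin k)) X] [MeasurableSpace X]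
    (F : HolomorphicCorrespondence k X) (d : ℕ) (μ : Measure X) : Prop :=
  ∀ φ : C(X, ℝ), F.pullback μ φ = d * ∫ z, φ z ∂μ

/-- The formula of the Koopman operator, on functions: the average of `φ` over the `d` preimages
of `z`. -/
noncomputable def koopman {k : ℕ} {X : Type*} [TopologicalSpace X]
    [ChartedSpace (EuclideanSpace ℂ (Fin k)) X] (F : HolomorphicCorrespondence k X) (d : ℕ)
    {𝕜 : Type*} [RCLike 𝕜] (φ : X → 𝕜) (z : X) : 𝕜 :=
  (1 / (d : 𝕜)) * F.sumPreimages φ z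

end HolomorphicCorrespondence

/-! If every point had exactly `d` preimages with multiplicity, `U_F φ (z)` would be an average,
Jensen would give `|U_F φ|^q ≤ U_F (|φ|^q)`, and integrating against the invariant measure would
give the contraction. Two points need work.

The total multiplicity need only be `d` almost everywhere. It is at least `d` at every `z`:
unramified points of full degree are dense, and by compactness the fibre over one of them close to
`z` lies near the fibre over `z` (`IsTopologicalDegree.le_sum_mult`). Invariance tested on `1` says
that its mean is `d`, so it equals `d` almost everywhere (`IsInvariant.sum_mult_ae_eq`). No upper
bound on multiplicities at ramified points enters.

Invariance is given for continuous functions only, with no measurability of sums over preimages.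
Both the identity and a.e. measurability pass to Borel functions (`IsInvariant.invariantAt`).
Applied to Borel null sets, the identity shows independence of the representative; applied to
`|φ|^q`, it gives the norm bound. -/

/-! ### Proper analytic subsets of connected manifolds are nowhere dense -/

section Analytic

/-- Identity theorem on a convex domain of a complex normed space. -/
theorem DifferentiableOn.eqOn_zero_of_convex {E G : Type*} [NormedAddCommGroup E]
    [NormedSpace ℂ E] [NormedAddCommGroup G] [NormedSpace ℂ G] [CompleteSpace G] {g : E → G}
    {B : Set E} (hg : DifferentiableOn ℂ g B) (hB : IsOpen B) (hBc : Convex ℝ B) {p : E}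
    (hp : p ∈ B) (h0 : ∀ᶠ y in 𝓝 p, g y = 0) {y : E} (hy : y ∈ B) : g y = 0 := by
  -- Restriction to the complex line through `p` and `y` reduces to one variable; convexity keeps
  -- the part of the line in `B` connected.
  let c : ℂ → E := fun t => p + t • (y - p)
  have hc : Continuous c := by fun_prop
  have hcd : Differentiable ℂ c := by
    intro t; fun_prop
  have hV : IsOpen (c ⁻¹' B) := hB.preimage hc
  have hVc : Convex ℝ (c ⁻¹' B) := by
    intro s hs t ht a b ha hb hab
    have := hBc hs ht ha hb hab
    have e : c (a • s + b • t) = a • c s + b • c t := by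
      have hp' : p = a • p + b • p := by rw [← add_smul, hab, one_smul]
      simp only [c, smul_add, add_smul, smul_assoc]
      nth_rewrite 1 [hp']
      abel
    simpa only [Set.mem_preimage, e] using this
  have hd : DifferentiableOn ℂ (g ∘ c) (c ⁻¹' B) :=
    hg.comp hcd.differentiableOn (fun _ h => h)
  have h00 : c 0 = p := by simp [c]
  have h11 : c 1 = y := by simp [c]
  have hz : (g ∘ c) =ᶠ[𝓝 0] 0 := by
    have : Filter.Tendsto c (𝓝 0) (𝓝 p) := by
      simpa [h00] using hc.tendsto 0
    exact this.eventually h0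
  have := (hd.analyticOnNhd hV).eqOn_zero_of_preconnected_of_eventuallyEq_zero
    hVc.isPreconnected (z₀ := 0) (by simpa [h00] using hp) hz
    (show (1 : ℂ) ∈ c ⁻¹' B by simpa [h11] using hy)
  simpa [h11] using this

variable {E H M : Type*} [NormedAddCommGroup E] [NormedSpace ℂ E]
    [TopologicalSpace H] [TopologicalSpace M] [ChartedSpace H M] {I : ModelWithCorners ℂ E H}
    {A : Set M}

theorem IsAnalyticSubset.isClosed (hA : IsAnalyticSubset I A) : IsClosed A := by
  rw [← isOpen_compl_iff, isOpen_iff_mem_nhds]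
  intro x hx
  obtain ⟨U, hU, hxU, n, f, hf, hAU⟩ := hA x
  have hfx : f x ≠ 0 := fun h => hx ((hAU.symm ▸ ⟨hxU, h⟩ : x ∈ A ∩ U).1)
  have hc : ContinuousAt f x := (hf.continuousOn).continuousAt (hU.mem_nhds hxU)
  filter_upwards [hc.eventually_ne hfx, hU.mem_nhds hxU] with y hy hyU hyA
  exact hy ((hAU ▸ ⟨hyA, hyU⟩ : y ∈ {y | y ∈ U ∧ f y = 0}).2)

/-- By the identity theorem in a chart ball, a limit point of the interior of `A` is again interior.
The interior is thus clopen, hence empty when `A` is proper. -/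
theorem IsAnalyticSubset.dense_compl [I.Boundaryless] [IsManifold I 1 M] [PreconnectedSpace M]
    (hA : IsAnalyticSubset I A) (hne : A ≠ Set.univ) : Dense Aᶜ := by
  rw [← interior_eq_empty_iff_dense_compl]
  suffices h : closure (interior A) ⊆ interior A by
    have hcl : IsClopen (interior A) := ⟨closure_subset_iff_isClosed.mp h, isOpen_interior⟩
    rcases isClopen_iff.mp hcl with h | h
    · exact h
    · exact absurd (Set.univ_subset_iff.mp (h ▸ interior_subset)) hne
  intro x hx
  obtain ⟨U, hU, hxU, n, f, hf, hAU⟩ := hA x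
  set e := extChartAt I x
  have hO : IsOpen (e.target ∩ e.symm ⁻¹' U) :=
    (continuousOn_extChartAt_symm x).isOpen_inter_preimage (isOpen_extChartAt_target x) hU
  have hex : e x ∈ e.target ∩ e.symm ⁻¹' U :=
    ⟨mem_extChartAt_target x, by simpa [e, extChartAt_to_inv] using hxU⟩
  obtain ⟨r, hr, hball⟩ := Metric.isOpen_iff.mp hO _ hex
  have hg : DifferentiableOn ℂ (f ∘ e.symm) (Metric.ball (e x) r) := by
    rw [← mdifferentiableOn_iff_differentiableOn]
    refine hf.comp ((mdifferentiableOn_extChartAt_symm (I := I) (x := x)).mono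
      fun y hy => (hball hy).1) fun y hy => (hball hy).2
  have hW : IsOpen (e.source ∩ e ⁻¹' Metric.ball (e x) r) :=
    (continuousOn_extChartAt x).isOpen_inter_preimage (isOpen_extChartAt_source x)
      Metric.isOpen_ball
  have hxW : x ∈ e.source ∩ e ⁻¹' Metric.ball (e x) r :=
    ⟨mem_extChartAt_source x, Metric.mem_ball_self hr⟩
  obtain ⟨y, ⟨hys, hyB⟩, hyA⟩ := mem_closure_iff.mp hx _ hW hxW
  have hzero : ∀ᶠ v in 𝓝 (e y), (f ∘ e.symm) v = 0 := by
    have ht : Filter.Tendsto e.symm (𝓝 (e y)) (𝓝 y) := by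
      have := (continuousOn_extChartAt_symm (I := I) x).continuousAt
        ((isOpen_extChartAt_target x).mem_nhds (e.map_source hys))
      rwa [ContinuousAt, e.left_inv hys] at this
    have hyU : y ∈ U := by simpa [e.left_inv hys] using (hball hyB).2
    filter_upwards [ht.eventually (isOpen_interior.mem_nhds hyA),
      ht.eventually (hU.mem_nhds hyU)] with v hv hvU
    exact (hAU ▸ ⟨interior_subset hv, hvU⟩ : e.symm v ∈ {y | y ∈ U ∧ f y = 0}).2
  refine mem_interior.mpr ⟨_, fun w hw => ?_, hW, hxW⟩
  have h0 := hg.eqOn_zero_of_convex Metric.isOpen_ball (convex_ball _ _) hyB hzero hw.2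
  have hwU : w ∈ U := by simpa [e.left_inv hw.1] using (hball hw.2).2
  have hfw : f w = 0 := by simpa [e.left_inv hw.1] using h0
  exact (hAU.symm ▸ ⟨hwU, hfw⟩ : w ∈ A ∩ U).1

end Analytic

/-! ### The number of preimages, counted with multiplicity -/

namespace HolomorphicCorrespondence

variable {k : ℕ} {X : Type*} [TopologicalSpace X] [ChartedSpace (EuclideanSpace ℂ (Fin k)) X]
  (F : HolomorphicCorrespondence k X)

theorem finite_fiber (j : Fin F.N) (z : X) : {w | (w, z) ∈ F.Γ j}.Finite :=
  (F.finite_preimage z).subset fun _ h => ⟨j, h⟩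

theorem mem_preimage {w z : X} : w ∈ F.preimage z ↔ ∃ j, (w, z) ∈ F.Γ j := by
  simp [preimage]

theorem isClosed_component (j : Fin F.N) : IsClosed (F.Γ j) :=
  (F.irreducible j).1.isClosed

/-- The cardinality of the fibres is locally constant on the unramified locus. -/
theorem eventually_ncard_fiber_eq {j : Fin F.N} {z : X} (hz : z ∈ F.unramifiedLocus j) :
    ∀ᶠ z' in 𝓝 z, {w | (w, z') ∈ F.Γ j}.ncard = {w | (w, z) ∈ F.Γ j}.ncard := by
  obtain ⟨-, U, hzU, hU, -, e, he⟩ := hz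
  have key : ∀ z' ∈ U, {w | (w, z') ∈ F.Γ j}.ncard =
      Nat.card ((fun p : F.Γ j => p.1.2) ⁻¹' {z}) := by
    intro z' hz'
    rw [← Nat.card_coe_set_eq]
    -- The local trivialization `e` identifies every fibre over `U` with the one fixed fibre over
    -- `z`.
    refine Nat.card_congr
      { toFun := fun w => (e ⟨⟨(w.1, z'), w.2⟩, hz'⟩).2
        invFun := fun i => ⟨(e.symm (⟨z', hz'⟩, i)).1.1.1, ?_⟩
        left_inv := ?_
        right_inv := ?_ }
    · have h1 := he (e.symm (⟨z', hz'⟩, i))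
      simp only [Homeomorph.apply_symm_apply] at h1
      have h2 := (e.symm (⟨z', hz'⟩, i)).1.2
      have h3 : ((e.symm (⟨z', hz'⟩, i)).1.1.1, z') = (e.symm (⟨z', hz'⟩, i)).1.1 :=
        Prod.ext rfl h1
      exact h3 ▸ h2
    · intro w
      have h : ((⟨z', hz'⟩ : U), (e ⟨⟨(w.1, z'), w.2⟩, hz'⟩).2) = e ⟨⟨(w.1, z'), w.2⟩, hz'⟩ :=
        Prod.ext (Subtype.ext (he ⟨⟨(w.1, z'), w.2⟩, hz'⟩).symm) rfl
      apply Subtype.ext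
      simp only [h, Homeomorph.symm_apply_apply]
    · intro i
      have h1 := he (e.symm (⟨z', hz'⟩, i))
      simp only [Homeomorph.apply_symm_apply] at h1
      have h3 : ∀ (h : ((e.symm (⟨z', hz'⟩, i)).1.1.1, z') ∈ F.Γ j),
          (⟨⟨((e.symm (⟨z', hz'⟩, i)).1.1.1, z'), h⟩, hz'⟩ :
            (fun p : F.Γ j => p.1.2) ⁻¹' U) = e.symm (⟨z', hz'⟩, i) :=
        fun h => Subtype.ext (Subtype.ext (Prod.ext rfl h1))
      simp only [h3, Homeomorph.apply_symm_apply]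
  filter_upwards [hU.mem_nhds hzU] with z' hz'
  rw [key z' hz', key z hzU]

/-- Preimages of points close to `z` are close to preimages of `z`. -/
theorem eventually_fiber_subset [CompactSpace X] (j : Fin F.N) (z : X) {V : Set X} (hV : IsOpen V)
    (h : ∀ w, (w, z) ∈ F.Γ j → w ∈ V) : ∀ᶠ z' in 𝓝 z, ∀ w, (w, z') ∈ F.Γ j → w ∈ V := by
  -- Projection along the compact first factor is closed, so the points with a preimage outside `V`
  -- form a closed set.
  have hc : IsClosed (Prod.snd '' (F.Γ j ∩ Prod.fst ⁻¹' Vᶜ)) :=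
    isClosedMap_snd_of_compactSpace _
      ((F.isClosed_component j).inter (hV.isClosed_compl.preimage continuous_fst))
  have hz : z ∉ Prod.snd '' (F.Γ j ∩ Prod.fst ⁻¹' Vᶜ) := by
    rintro ⟨⟨w, z⟩, ⟨h1, h2⟩, rfl⟩
    exact h2 (h w h1)
  filter_upwards [hc.isOpen_compl.mem_nhds hz] with z' hz' w hw
  by_contra hwV
  exact hz' ⟨(w, z'), ⟨hw, hwV⟩, rfl⟩

section Degree

variable [ConnectedSpace X] [IsManifold 𝓘(ℂ, EuclideanSpace ℂ (Fin k)) ω X] {F} {d : ℕ}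

theorem IsTopologicalDegree.exists_dense (hd : F.IsTopologicalDegree d) :
    ∃ S : Set X, Dense S ∧ ∀ z ∈ S, (∀ j, z ∈ F.unramifiedLocus j) ∧
      ∑ j, F.m j * {w | (w, z) ∈ F.Γ j}.ncard = d := by
  have : IsManifold 𝓘(ℂ, EuclideanSpace ℂ (Fin k)) 1 X := IsManifold.of_le (n := ω) le_top
  obtain ⟨A, hA, hne, h⟩ := hd
  exact ⟨Aᶜ, hA.dense_compl hne, h⟩

theorem IsTopologicalDegree.pos (hd : F.IsTopologicalDegree d) : 0 < d := by
  obtain ⟨S, hS, h⟩ := hd.exists_dense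
  obtain ⟨z, hz⟩ := hS.nonempty
  rw [← (h z hz).2]
  let j : Fin F.N := ⟨0, F.N_pos⟩
  obtain ⟨⟨w, z'⟩, hw, rfl⟩ : z ∈ Prod.snd '' F.Γ j := by simp [F.surjective_snd j]
  have hpos : 0 < {w | (w, z') ∈ F.Γ j}.ncard :=
    (Set.ncard_pos (F.finite_fiber j z')).mpr ⟨w, hw⟩
  exact (Nat.mul_pos (F.m_pos j) hpos).trans_le
    (Finset.single_le_sum (f := fun j => F.m j * {w | (w, z') ∈ F.Γ j}.ncard)
      (fun _ _ => Nat.zero_le _) (Finset.mem_univ j))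

/-- An unramified point may lie in the exceptional analytic set; local constancy of the fibre
cardinality moves the count to a nearby generic point. -/
theorem IsTopologicalDegree.ncard_fiber_le (hd : F.IsTopologicalDegree d) {j : Fin F.N} {z : X}
    (hz : z ∈ F.unramifiedLocus j) : {w | (w, z) ∈ F.Γ j}.ncard ≤ d := by
  obtain ⟨S, hS, h⟩ := hd.exists_dense
  obtain ⟨z', hz', hzS⟩ :=
    (mem_closure_iff_nhds.mp (hS z)) _ (F.eventually_ncard_fiber_eq hz)
  rw [← hz', ← (h z' hzS).2]
  exact (Nat.le_mul_of_pos_left _ (F.m_pos j)).trans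
    (Finset.single_le_sum (f := fun j => F.m j * {w | (w, z') ∈ F.Γ j}.ncard)
      (fun _ _ => Nat.zero_le _) (Finset.mem_univ j))

/-- The infimum defining the local multiplicity is attained. -/
theorem IsTopologicalDegree.exists_nhds_ncard_le (hd : F.IsTopologicalDegree d) (j : Fin F.N)
    (w z : X) : ∃ V ∈ 𝓝 w, ∀ᶠ z' in 𝓝[F.unramifiedLocus j] z,
      {w' | w' ∈ V ∧ (w', z') ∈ F.Γ j}.ncard ≤ F.localMult j w z := by
  -- Since `sInf ∅ = 0` in `ℕ`, some admissible bound must be exhibited: `d` works, with the whole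
  -- space as neighbourhood.
  refine Nat.sInf_mem (s := {n : ℕ | ∃ V ∈ 𝓝 w, ∀ᶠ z' in 𝓝[F.unramifiedLocus j] z,
    {w' | w' ∈ V ∧ (w', z') ∈ F.Γ j}.ncard ≤ n}) ⟨d, Set.univ, Filter.univ_mem, ?_⟩
  filter_upwards [self_mem_nhdsWithin] with z' hz'
  simpa using hd.ncard_fiber_le hz'

/-- Every point has at least `d` preimages, counted with multiplicity. -/
theorem IsTopologicalDegree.le_sum_mult [CompactSpace X] (hd : F.IsTopologicalDegree d) (z : X) :
    d ≤ ∑ w ∈ F.preimage z, F.mult w z := by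
  classical
  choose V hV hVle using fun (j : Fin F.N) (w : X) => hd.exists_nhds_ncard_le j w z
  have h1 : ∀ j, ∀ᶠ z' in 𝓝 z, ∀ w, (w, z') ∈ F.Γ j →
      w ∈ ⋃ v ∈ F.preimage z, interior (V j v) := fun j =>
    F.eventually_fiber_subset j z (isOpen_biUnion fun _ _ => isOpen_interior) fun w hw =>
      Set.mem_biUnion (F.mem_preimage.mpr ⟨j, hw⟩) (mem_interior_iff_mem_nhds.mpr (hV j w))
  have h2 : ∀ j, ∀ᶠ z' in 𝓝 z, z' ∈ F.unramifiedLocus j → ∀ w ∈ F.preimage z,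
      {w' | w' ∈ V j w ∧ (w', z') ∈ F.Γ j}.ncard ≤ F.localMult j w z := fun j => by
    rw [← eventually_nhdsWithin_iff]
    exact (Filter.eventually_all_finset _).mpr fun w _ => hVle j w
  obtain ⟨S, hS, h⟩ := hd.exists_dense
  -- A single generic `z'` near `z` serves all components: its fibres are covered by the chosen
  -- neighbourhoods, each holding at most the local multiplicity. The neighbourhoods may overlap, so
  -- only an inequality results.
  obtain ⟨z', ⟨hz1, hz2⟩, hzS⟩ := mem_closure_iff_nhds.mp (hS z) _
    ((Filter.eventually_all.mpr h1).and (Filter.eventually_all.mpr h2))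
  obtain ⟨hun, hdeg⟩ := h z' hzS
  calc d = ∑ j, F.m j * {w | (w, z') ∈ F.Γ j}.ncard := hdeg.symm
    _ ≤ ∑ j, F.m j * ∑ w ∈ F.preimage z, F.localMult j w z := by
      refine Finset.sum_le_sum fun j _ => Nat.mul_le_mul_left _ ?_
      calc {w | (w, z') ∈ F.Γ j}.ncard
          ≤ (⋃ v ∈ F.preimage z, {w | w ∈ V j v ∧ (w, z') ∈ F.Γ j}).ncard := by
            refine Set.ncard_le_ncard (fun w hw => ?_)
              ((F.preimage z).finite_toSet.biUnion fun v _ =>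
                (F.finite_fiber j z').subset fun _ h => h.2)
            obtain ⟨v, hv, hwv⟩ := Set.mem_iUnion₂.mp (hz1 j w hw)
            exact Set.mem_biUnion hv ⟨interior_subset hwv, hw⟩
        _ ≤ ∑ v ∈ F.preimage z, {w | w ∈ V j v ∧ (w, z') ∈ F.Γ j}.ncard :=
            Finset.set_ncard_biUnion_le _ _
        _ ≤ _ := Finset.sum_le_sum fun w hw => hz2 j (hun j) w hw
    _ = ∑ w ∈ F.preimage z, F.mult w z := by
      simp only [mult, Finset.mul_sum]
      exact Finset.sum_comm

end Degree

variable {d : ℕ}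

/-! ### Algebraic properties of the sum over preimages -/

section Algebra

theorem sumPreimages_add {V : Type*} [AddCommMonoid V] (f g : X → V) (z : X) :
    F.sumPreimages (f + g) z = F.sumPreimages f z + F.sumPreimages g z := by
  simp [sumPreimages, Finset.sum_add_distrib]

theorem sumPreimages_mul_left {R : Type*} [Semiring R] (c : R) (f : X → R) (z : X) :
    F.sumPreimages (fun w => c * f w) z = c * F.sumPreimages f z := by
  simp only [sumPreimages, Finset.mul_sum, mul_smul_comm]

theorem sumPreimages_map {V W : Type*} [AddCommMonoid V] [AddCommMonoid W] (L : V →+ W)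
    (f : X → V) (z : X) : F.sumPreimages (fun w => L (f w)) z = L (F.sumPreimages f z) := by
  simp [sumPreimages]

theorem sumPreimages_one {R : Type*} [Semiring R] (z : X) :
    F.sumPreimages (1 : X → R) z = ((∑ w ∈ F.preimage z, F.mult w z : ℕ) : R) := by
  simp [sumPreimages]

theorem tendsto_sumPreimages {V ι : Type*} [AddCommMonoid V] [TopologicalSpace V]
    [ContinuousAdd V] {l : Filter ι} {f : ι → X → V} {g : X → V}
    (h : ∀ w, Filter.Tendsto (fun i => f i w) l (𝓝 (g w))) (z : X) :
    Filter.Tendsto (fun i => F.sumPreimages (f i) z) l (𝓝 (F.sumPreimages g z)) :=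
  tendsto_finsetSum _ fun w _ => ((continuous_nsmul _).tendsto _).comp (h w)

theorem sumPreimages_tsum (f : ℕ → X → ℝ≥0∞) (z : X) :
    F.sumPreimages (fun w => ∑' n, f n w) z = ∑' n, F.sumPreimages (f n) z := by
  simp only [sumPreimages, nsmul_eq_mul, ← ENNReal.tsum_mul_left]
  exact (Summable.tsum_finsetSum fun _ _ => ENNReal.summable).symm

theorem sumPreimages_iSup {f : ℕ → X → ℝ≥0∞} (hf : Monotone f) (z : X) :
    F.sumPreimages (fun w => ⨆ n, f n w) z = ⨆ n, F.sumPreimages (f n) z := by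
  simp only [sumPreimages, nsmul_eq_mul, ENNReal.mul_iSup]
  exact ENNReal.finsetSum_iSup_of_monotone fun w i j hij => mul_le_mul_right (hf hij w) _

theorem sumPreimages_mono {f g : X → ℝ≥0∞} (h : f ≤ g) (z : X) :
    F.sumPreimages f z ≤ F.sumPreimages g z :=
  Finset.sum_le_sum fun w _ => nsmul_le_nsmul_right (h w) _

theorem sumPreimages_ne_top {g : X → ℝ≥0∞} (hg : ∀ w, g w ≠ ⊤) (z : X) :
    F.sumPreimages g z ≠ ⊤ := by
  simp only [sumPreimages, nsmul_eq_mul]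
  exact ENNReal.sum_ne_top.mpr fun w _ => ENNReal.mul_ne_top (by simp) (hg w)

end Algebra

/-! ### Algebraic properties of the Koopman operator -/

section KoopmanAlgebra

variable {F} {𝕜 : Type*} [RCLike 𝕜]

theorem koopman_add (f g : X → 𝕜) : F.koopman d (f + g) = F.koopman d f + F.koopman d g := by
  ext z
  simp [koopman, sumPreimages_add, mul_add]

theorem koopman_smul (c : 𝕜) (f : X → 𝕜) : F.koopman d (c • f) = c • F.koopman d f := by
  ext z
  have := F.sumPreimages_mul_left c f z
  simp only [koopman, Pi.smul_apply, smul_eq_mul]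
  rw [mul_left_comm, ← this]
  rfl

/-- Jensen's inequality for `t ↦ t ^ p` with weights `mult / d`, which sum to `1` by `hz`. -/
theorem enorm_koopman_rpow_le {f : X → 𝕜} {z : X} (hd : 0 < d)
    (hz : ∑ w ∈ F.preimage z, F.mult w z = d) {p : ℝ} (hp : 1 ≤ p) :
    ‖F.koopman d f z‖ₑ ^ p ≤ (d : ℝ≥0∞)⁻¹ * F.sumPreimages (fun w => ‖f w‖ₑ ^ p) z := by
  have hd0 : (d : ℝ≥0∞) ≠ 0 := by simp [hd.ne']
  have h1 : ‖F.koopman d f z‖ₑ ≤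
      ∑ w ∈ F.preimage z, (d : ℝ≥0∞)⁻¹ * F.mult w z * ‖f w‖ₑ := by
    have hinv : ‖(1 / (d : 𝕜))‖ₑ = (d : ℝ≥0∞)⁻¹ := by
      rw [one_div, enorm_inv (by simp [hd.ne'])]
      simp [enorm_eq_nnnorm]
    rw [koopman, enorm_mul, hinv]
    simp only [mul_assoc, ← Finset.mul_sum]
    gcongr
    refine (enorm_sum_le _ _).trans (Finset.sum_le_sum fun w _ => ?_)
    rw [nsmul_eq_mul, enorm_mul]
    simp [enorm_eq_nnnorm]
  have hw : ∑ w ∈ F.preimage z, (d : ℝ≥0∞)⁻¹ * F.mult w z = 1 := by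
    rw [← Finset.mul_sum, ← Nat.cast_sum, hz, ENNReal.inv_mul_cancel hd0 (by simp)]
  calc ‖F.koopman d f z‖ₑ ^ p
      ≤ (∑ w ∈ F.preimage z, (d : ℝ≥0∞)⁻¹ * F.mult w z * ‖f w‖ₑ) ^ p := by gcongr
    _ ≤ ∑ w ∈ F.preimage z, (d : ℝ≥0∞)⁻¹ * F.mult w z * ‖f w‖ₑ ^ p :=
        ENNReal.rpow_arith_mean_le_arith_mean_rpow _ _ _ hw hp
    _ = _ := by simp [sumPreimages, Finset.mul_sum, mul_assoc]

end KoopmanAlgebra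

variable [MeasurableSpace X] {F} {μ : Measure X}

/-! ### Consequences of invariance for continuous functions -/

section Continuous

variable [IsProbabilityMeasure μ]

theorem IsInvariant.integral_one (hμ : F.IsInvariant d μ) :
    ∫ z, F.sumPreimages (1 : X → ℝ) z ∂μ = d := by
  simpa [pullback] using hμ 1

/-- The Bochner integral of a non-integrable function is `0` by convention, so a nonzero integral
certifies integrability, and with it a.e. measurability. -/
theorem IsInvariant.integrable_one (hμ : F.IsInvariant d μ) (hd : 0 < d) :
    Integrable (F.sumPreimages (1 : X → ℝ)) μ :=
  .of_integral_ne_zero <| by rw [hμ.integral_one]; positivity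

variable [CompactSpace X] [BorelSpace X]

theorem IsInvariant.integrable (hμ : F.IsInvariant d μ) (hd : 0 < d) (φ : C(X, ℝ)) :
    Integrable (F.sumPreimages φ) μ := by
  have hd' : (d : ℝ) ≠ 0 := by positivity
  -- A zero mean certifies nothing; `φ + 1` then has mean `1`, and the sum for `1` is subtracted.
  by_cases h : ∫ z, φ z ∂μ = 0
  · have h1 : Integrable (F.sumPreimages (φ + 1 : C(X, ℝ))) μ := by
      refine .of_integral_ne_zero ?_
      have := hμ (φ + 1)
      have hφ : Integrable φ μ :=
        φ.continuous.integrable_of_hasCompactSupport (HasCompactSupport.of_compactSpace φ)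
      rw [pullback] at this
      rw [this]
      simp only [ContinuousMap.add_apply, ContinuousMap.one_apply]
      rw [integral_add hφ (integrable_const 1), h]
      simpa using hd'
    have h2 := h1.sub (hμ.integrable_one hd)
    convert h2 using 1
    ext z
    have := F.sumPreimages_add φ (1 : X → ℝ) z
    rw [Pi.sub_apply, eq_sub_iff_add_eq, ← this]
    rfl
  · exact .of_integral_ne_zero <| by
      rw [show ∫ z, F.sumPreimages φ z ∂μ = _ from hμ φ]
      exact mul_ne_zero hd' h

end Continuous

/-! ### Extension to Borel functions -/

/-- The invariance identity for a `[0, ∞]`-valued function. -/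
def InvariantAt (F : HolomorphicCorrespondence k X) (d : ℕ) (μ : Measure X) (g : X → ℝ≥0∞) :
    Prop :=
  AEMeasurable (F.sumPreimages g) μ ∧ ∫⁻ z, F.sumPreimages g z ∂μ = d * ∫⁻ z, g z ∂μ

section Borel

variable [IsProbabilityMeasure μ] [CompactSpace X] [BorelSpace X]

theorem IsInvariant.invariantAt_continuous (hμ : F.IsInvariant d μ) (hd : 0 < d)
    (φ : C(X, NNReal)) : InvariantAt F d μ (fun z => (φ z : ℝ≥0∞)) := by
  let ψ : C(X, ℝ) := ⟨fun z => (φ z : ℝ), by fun_prop⟩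
  have hint := hμ.integrable hd ψ
  have hψ : Integrable ψ μ :=
    ψ.continuous.integrable_of_hasCompactSupport (HasCompactSupport.of_compactSpace ψ)
  have hcoe : ∀ z, F.sumPreimages (fun z => (φ z : ℝ≥0∞)) z =
      ENNReal.ofReal (F.sumPreimages ψ z) := by
    intro z
    have h1 := F.sumPreimages_map (ENNReal.ofNNRealHom : NNReal →+ ℝ≥0∞) φ z
    have h2 := F.sumPreimages_map (NNReal.toRealHom : NNReal →+ ℝ) φ z
    change F.sumPreimages ψ z = ((F.sumPreimages φ z : NNReal) : ℝ) at h2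
    rw [h2, ENNReal.ofReal_coe_nnreal]
    exact h1
  have hnn : ∀ z, 0 ≤ F.sumPreimages ψ z := fun z =>
    Finset.sum_nonneg fun w _ => nsmul_nonneg (φ w).2 _
  refine ⟨?_, ?_⟩
  · rw [show F.sumPreimages (fun z => (φ z : ℝ≥0∞)) = _ from funext hcoe]
    exact hint.aestronglyMeasurable.aemeasurable.ennreal_ofReal
  · simp only [hcoe]
    rw [← ofReal_integral_eq_lintegral_ofReal hint (.of_forall hnn),
      show ∫ z, F.sumPreimages ψ z ∂μ = _ from hμ ψ, ENNReal.ofReal_mul (by positivity),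
      ofReal_integral_eq_lintegral_ofReal hψ (.of_forall fun z => (φ z).2)]
    simp [ψ]

theorem IsInvariant.invariantAt_one (hμ : F.IsInvariant d μ) (hd : 0 < d) :
    InvariantAt F d μ 1 := by
  exact hμ.invariantAt_continuous hd 1

/-- Continuous functions bounded by `1` converge pointwise to the indicator; their sums over
preimages are dominated by that of `1`, whose integral `d` is finite. -/
theorem IsInvariant.invariantAt_isClosed [HasOuterApproxClosed X] (hμ : F.IsInvariant d μ)
    (hd : 0 < d) {K : Set X} (hK : IsClosed K) : InvariantAt F d μ (K.indicator 1) := by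
  let φ : ℕ → X → ℝ≥0∞ := fun n x => (hK.apprSeq n x : ℝ≥0∞)
  have hφ : ∀ n, InvariantAt F d μ (φ n) := fun n =>
    hμ.invariantAt_continuous hd (hK.apprSeq n).toContinuousMap
  have hφ1 : ∀ n, φ n ≤ 1 := fun n x => by
    simpa [φ] using HasOuterApproxClosed.apprSeq_apply_le_one hK n x
  have hlim : ∀ w, Filter.Tendsto (fun n => φ n w) Filter.atTop (𝓝 (K.indicator 1 w)) := by
    intro w
    have := tendsto_pi_nhds.mp (HasOuterApproxClosed.tendsto_apprSeq hK) w
    have h2 := (ENNReal.continuous_coe.tendsto _).comp this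
    rwa [show (K.indicator 1 w : ℝ≥0∞) = ((K.indicator (fun _ => 1) w : NNReal) : ℝ≥0∞) by
      by_cases hw : w ∈ K <;> simp [hw]]
  have hT := F.tendsto_sumPreimages hlim
  have hone := hμ.invariantAt_one hd
  refine ⟨aemeasurable_of_tendsto_metrizable_ae _ (fun n => (hφ n).1) (.of_forall hT), ?_⟩
  have h1 := tendsto_lintegral_of_dominated_convergence' (μ := μ) (F.sumPreimages 1)
    (fun n => (hφ n).1) (fun n => .of_forall fun z => F.sumPreimages_mono (hφ1 n) z)
    (by rw [hone.2]; simp) (.of_forall hT)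
  have h2 := HasOuterApproxClosed.tendsto_lintegral_apprSeq hK μ
  have h3 := ENNReal.Tendsto.const_mul (a := (d : ℝ≥0∞)) h2 (.inr (by simp))
  simp only [fun n => (hφ n).2] at h1
  rw [tendsto_nhds_unique h1 h3, lintegral_indicator_one hK.measurableSet]

/-- A π-λ argument from the closed sets; finiteness of the integrals permits the subtraction for
complements. -/
theorem IsInvariant.invariantAt_indicator [HasOuterApproxClosed X] (hμ : F.IsInvariant d μ)
    (hd : 0 < d) {B : Set X} (hB : MeasurableSet B) : InvariantAt F d μ (B.indicator 1) := by
  have hone := hμ.invariantAt_one hd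
  induction B, hB using MeasurableSpace.induction_on_inter
    ((BorelSpace.measurable_eq (α := X)).trans borel_eq_generateFrom_isClosed)
    isPiSystem_isClosed with
  | empty =>
    have h : F.sumPreimages (Set.indicator (∅ : Set X) (1 : X → ℝ≥0∞)) = 0 := by
      ext z; simp [sumPreimages]
    rw [InvariantAt, h]
    exact ⟨aemeasurable_const, by simp⟩
  | basic K hK => exact hμ.invariantAt_isClosed hd hK
  | compl B hB ih =>
    have hadd : ∀ z, F.sumPreimages (Bᶜ.indicator (1 : X → ℝ≥0∞)) z =
        F.sumPreimages 1 z - F.sumPreimages (B.indicator 1) z := fun z => by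
      refine ENNReal.eq_sub_of_add_eq (F.sumPreimages_ne_top (fun w => ?_) z) ?_
      · by_cases hw : w ∈ B <;> simp [hw]
      · rw [← sumPreimages_add, Set.indicator_compl_add_self]
    refine ⟨?_, ?_⟩
    · rw [show F.sumPreimages (Bᶜ.indicator (1 : X → ℝ≥0∞)) = _ from funext hadd]
      exact hone.1.sub ih.1
    · simp only [hadd]
      rw [lintegral_sub' ih.1, hone.2, ih.2, lintegral_indicator_one hB,
        lintegral_indicator_one hB.compl, prob_compl_eq_one_sub hB]
      · simp [ENNReal.mul_sub]
      · rw [ih.2]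
        exact ENNReal.mul_ne_top (by simp) (by simp [lintegral_indicator_one hB])
      · exact .of_forall fun z => F.sumPreimages_mono
          (Set.indicator_le_self' fun _ _ => zero_le) z
  | iUnion f hdisj hf ih =>
    have hsum : (Set.indicator (⋃ i, f i) 1 : X → ℝ≥0∞) = fun w => ∑' n, (f n).indicator 1 w := by
      ext w
      by_cases hw : w ∈ ⋃ i, f i
      · obtain ⟨n, hn⟩ := Set.mem_iUnion.mp hw
        rw [tsum_eq_single n fun m hm => Set.indicator_of_notMem
          (fun hw' => Set.disjoint_left.mp (hdisj hm) hw' hn) _]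
        simp [hw, hn]
      · have h : ∀ n, w ∉ f n := fun n hn => hw (Set.mem_iUnion.mpr ⟨n, hn⟩)
        simp [hw, h]
    have hT : F.sumPreimages (Set.indicator (⋃ i, f i) (1 : X → ℝ≥0∞)) =
        fun z => ∑' n, F.sumPreimages ((f n).indicator 1) z := by
      ext z; rw [hsum, sumPreimages_tsum]
    refine ⟨?_, ?_⟩
    · rw [hT]
      exact AEMeasurable.tsum fun n => (ih n).1
    · rw [hT, lintegral_tsum fun n => (ih n).1, lintegral_indicator_one (.iUnion hf),
        measure_iUnion hdisj hf, ← ENNReal.tsum_mul_left]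
      exact tsum_congr fun n => by rw [(ih n).2, lintegral_indicator_one (hf n)]

/-- The invariance identity extends to all `[0, ∞]`-valued Borel functions. -/
theorem IsInvariant.invariantAt [HasOuterApproxClosed X] (hμ : F.IsInvariant d μ) (hd : 0 < d)
    {g : X → ℝ≥0∞} (hg : Measurable g) : InvariantAt F d μ g := by
  refine Measurable.ennreal_induction (motive := InvariantAt F d μ) (fun c B hB => ?_)
    (fun f g _ hf hg ihf ihg => ?_) (fun f hf hmono ih => ?_) hg
  · have h : (B.indicator fun _ => c) = fun w => c * B.indicator (1 : X → ℝ≥0∞) w := by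
      ext w; by_cases hw : w ∈ B <;> simp [hw]
    have hT : F.sumPreimages (B.indicator fun _ => c) =
        fun z => c * F.sumPreimages (B.indicator 1) z := by
      ext z; rw [h, sumPreimages_mul_left]
    have hB' := hμ.invariantAt_indicator hd hB
    refine ⟨hT ▸ hB'.1.const_mul c, ?_⟩
    rw [hT, lintegral_const_mul'' c hB'.1, hB'.2, lintegral_indicator_one hB,
      lintegral_indicator_const hB, mul_left_comm]
  · have hT : F.sumPreimages (f + g) = F.sumPreimages f + F.sumPreimages g :=
      funext fun z => F.sumPreimages_add f g z
    refine ⟨hT ▸ ihf.1.add ihg.1, ?_⟩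
    rw [hT]
    simp only [Pi.add_apply]
    rw [lintegral_add_left' ihf.1, lintegral_add_left hf, ihf.2, ihg.2, mul_add]
  · have hT : F.sumPreimages (fun w => ⨆ n, f n w) = fun z => ⨆ n, F.sumPreimages (f n) z :=
      funext fun z => F.sumPreimages_iSup hmono z
    refine ⟨hT ▸ AEMeasurable.iSup fun n => (ih n).1, ?_⟩
    rw [hT, lintegral_iSup' (fun n => (ih n).1)
      (.of_forall fun z m n hmn => F.sumPreimages_mono (hmono hmn) z), lintegral_iSup hf hmono,
      ENNReal.mul_iSup]
    exact iSup_congr fun n => (ih n).2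

/-- The Koopman operator is well defined on classes of functions modulo `μ`-null sets. -/
theorem IsInvariant.sumPreimages_congr_ae [HasOuterApproxClosed X] (hμ : F.IsInvariant d μ)
    (hd : 0 < d) {V : Type*} [AddCommMonoid V] {f g : X → V} (h : f =ᵐ[μ] g) :
    F.sumPreimages f =ᵐ[μ] F.sumPreimages g := by
  -- The exceptional null set need not be Borel; it is enlarged to a Borel null set. Invariance then
  -- shows that, for almost every `z`, all preimages in `B` have multiplicity `0`.
  set B := toMeasurable μ {w | f w ≠ g w}
  have hB0 : μ B = 0 := (measure_toMeasurable _).trans h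
  have hBm : MeasurableSet B := measurableSet_toMeasurable _ _
  obtain ⟨hm, hi⟩ := hμ.invariantAt_indicator hd hBm
  rw [lintegral_indicator_one hBm, hB0, mul_zero, lintegral_eq_zero_iff' hm] at hi
  filter_upwards [hi] with z hz
  refine Finset.sum_congr rfl fun w hw => ?_
  have hw0 := (Finset.sum_eq_zero_iff.mp hz) w hw
  by_cases hwB : w ∈ B
  · have : F.mult w z = 0 := by simpa [hwB] using hw0
    simp [this]
  · have : f w = g w := by
      by_contra hne
      exact hwB (subset_toMeasurable _ _ hne)
    rw [this]

section Scalar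

variable {𝕜 : Type*} [RCLike 𝕜]

theorem IsInvariant.aestronglyMeasurable_sumPreimages [HasOuterApproxClosed X]
    (hμ : F.IsInvariant d μ) (hd : 0 < d) {f : X → 𝕜} (hf : StronglyMeasurable f) :
    AEStronglyMeasurable (F.sumPreimages f) μ := by
  suffices h : ∀ s : SimpleFunc X 𝕜, AEStronglyMeasurable (F.sumPreimages s) μ from
    aestronglyMeasurable_of_tendsto_ae Filter.atTop (fun n => h (hf.approx n))
      (.of_forall (F.tendsto_sumPreimages hf.tendsto_approx))
  intro s
  induction s using SimpleFunc.induction with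
  | const c hB =>
    rename_i B
    -- Expressing the sum through the `[0, ∞]`-valued indicator transfers the a.e. measurability
    -- already obtained.
    have hT : F.sumPreimages (B.indicator fun _ => c) =
        fun z => c * ((F.sumPreimages (B.indicator (1 : X → ℝ≥0∞)) z).toReal : 𝕜) := by
      ext z
      have h1 : ∀ w ∈ F.preimage z, F.mult w z • B.indicator (1 : X → ℝ≥0∞) w ≠ ⊤ := fun w _ => by
        by_cases hw : w ∈ B <;> simp [hw]
      simp only [sumPreimages]
      rw [ENNReal.toReal_sum h1, RCLike.ofReal_sum, Finset.mul_sum]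
      refine Finset.sum_congr rfl fun w _ => ?_
      by_cases hw : w ∈ B <;> simp [hw, mul_comm]
    have h0 := (hμ.invariantAt_indicator hd hB).1.ennreal_toReal
    have h1 := (RCLike.measurable_ofReal (𝕜 := 𝕜)).comp_aemeasurable h0
    have h2 : AEStronglyMeasurable (F.sumPreimages (B.indicator fun _ => c)) μ :=
      hT ▸ (h1.const_mul c).aestronglyMeasurable
    convert h2 using 2
    ext w
    by_cases hw : w ∈ B <;> simp [hw]
  | @add f g _ hf hg =>
    have hT : F.sumPreimages (⇑(f + g)) = F.sumPreimages f + F.sumPreimages g :=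
      funext fun z => F.sumPreimages_add f g z
    exact hT ▸ hf.add hg

theorem IsInvariant.koopman_congr_ae [HasOuterApproxClosed X] (hμ : F.IsInvariant d μ)
    (hd : 0 < d) {f g : X → 𝕜} (h : f =ᵐ[μ] g) : F.koopman d f =ᵐ[μ] F.koopman d g := by
  filter_upwards [hμ.sumPreimages_congr_ae hd h] with z hz
  rw [koopman, koopman, hz]

end Scalar

end Borel

/-! ### The Koopman operator on `L^q` -/

section Koopman

variable [CompactSpace X] [ConnectedSpace X] [IsManifold 𝓘(ℂ, EuclideanSpace ℂ (Fin k)) ω X]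
  [BorelSpace X] [IsProbabilityMeasure μ]

/-- Almost every point has exactly `d` preimages, counted with multiplicity. -/
theorem IsInvariant.sum_mult_ae_eq (hμ : F.IsInvariant d μ) (hd : F.IsTopologicalDegree d) :
    ∀ᵐ z ∂μ, ∑ w ∈ F.preimage z, F.mult w z = d := by
  obtain ⟨hm, hi⟩ := hμ.invariantAt_one hd.pos
  have hle : (fun _ => (d : ℝ≥0∞)) ≤ᵐ[μ] F.sumPreimages 1 := .of_forall fun z => by
    rw [sumPreimages_one]
    exact Nat.cast_le.mpr (hd.le_sum_mult z)
  -- A function bounded below by `d` whose integral is `d` equals `d` almost everywhere.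
  have := ae_eq_of_ae_le_of_lintegral_le hle (by simp) hm (by rw [hi]; simp)
  filter_upwards [this] with z hz
  rw [sumPreimages_one] at hz
  exact_mod_cast hz.symm

variable {𝕜 : Type*} [RCLike 𝕜]

theorem IsInvariant.eLpNorm_koopman_le [HasOuterApproxClosed X] (hμ : F.IsInvariant d μ)
    (hd : F.IsTopologicalDegree d) {f : X → 𝕜} (hf : StronglyMeasurable f) {q : ℝ≥0∞}
    (hq1 : 1 ≤ q) (hq : q ≠ ⊤) : eLpNorm (F.koopman d f) q μ ≤ eLpNorm f q μ := by
  have hd0 : (d : ℝ≥0∞) ≠ 0 := by simp [hd.pos.ne']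
  have hp : 1 ≤ q.toReal := by simpa using ENNReal.toReal_mono hq hq1
  have hq0 : q ≠ 0 := (zero_lt_one.trans_le hq1).ne'
  obtain ⟨hm, hi⟩ := hμ.invariantAt hd.pos (hf.enorm.pow_const q.toReal)
  simp only [eLpNorm_eq_lintegral_rpow_enorm_toReal hq0 hq]
  gcongr 1
  calc ∫⁻ z, ‖F.koopman d f z‖ₑ ^ q.toReal ∂μ
      ≤ ∫⁻ z, (d : ℝ≥0∞)⁻¹ * F.sumPreimages (fun w => ‖f w‖ₑ ^ q.toReal) z ∂μ := by
        refine lintegral_mono_ae ?_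
        filter_upwards [hμ.sum_mult_ae_eq hd] with z hz
        exact enorm_koopman_rpow_le hd.pos hz hp
    _ = ∫⁻ z, ‖f z‖ₑ ^ q.toReal ∂μ := by
        rw [lintegral_const_mul'' _ hm, hi, ← mul_assoc, ENNReal.inv_mul_cancel hd0 (by simp),
          one_mul]

theorem IsInvariant.memLp_koopman [HasOuterApproxClosed X] (hμ : F.IsInvariant d μ)
    (hd : F.IsTopologicalDegree d) {q : ℝ≥0∞} (hq1 : 1 ≤ q) (hq : q ≠ ⊤) (φ : Lp 𝕜 q μ) :
    MemLp (F.koopman d φ) q μ :=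
  ⟨(hμ.aestronglyMeasurable_sumPreimages hd.pos (Lp.stronglyMeasurable φ)).const_mul _,
    (hμ.eLpNorm_koopman_le hd (Lp.stronglyMeasurable φ) hq1 hq).trans_lt (Lp.memLp φ).2⟩

/-- The Koopman operator of an invariant measure, as a contraction of `L^q`. -/
noncomputable def koopmanLp [HasOuterApproxClosed X] (hμ : F.IsInvariant d μ)
    (hd : F.IsTopologicalDegree d) (q : ℝ≥0∞) [hq1 : Fact (1 ≤ q)] (hq : q ≠ ⊤) :
    Lp 𝕜 q μ →L[𝕜] Lp 𝕜 q μ :=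
  LinearMap.mkContinuous
    { toFun := fun φ => (hμ.memLp_koopman hd hq1.out hq φ).toLp
      map_add' := fun φ ψ => by
        rw [← MemLp.toLp_add, MemLp.toLp_eq_toLp_iff, ← koopman_add]
        exact hμ.koopman_congr_ae hd.pos (Lp.coeFn_add φ ψ)
      map_smul' := fun c φ => by
        rw [RingHom.id_apply, ← MemLp.toLp_const_smul, MemLp.toLp_eq_toLp_iff, ← koopman_smul]
        exact hμ.koopman_congr_ae hd.pos (Lp.coeFn_smul c φ) }
    1 fun φ => by
      rw [one_mul, Lp.norm_def φ]
      refine (Lp.norm_toLp _ (hμ.memLp_koopman hd hq1.out hq φ)).trans_le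
        (ENNReal.toReal_mono (Lp.eLpNorm_ne_top φ) ?_)
      exact hμ.eLpNorm_koopman_le hd (Lp.stronglyMeasurable φ) hq1.out hq

theorem koopmanLp_ae_eq [HasOuterApproxClosed X] (hμ : F.IsInvariant d μ)
    (hd : F.IsTopologicalDegree d) (q : ℝ≥0∞) [hq1 : Fact (1 ≤ q)] (hq : q ≠ ⊤) (φ : Lp 𝕜 q μ)
    {f : X → 𝕜} (h : φ =ᵐ[μ] f) : koopmanLp hμ hd q hq φ =ᵐ[μ] F.koopman d f :=
  (hμ.memLp_koopman hd hq1.out hq φ).coeFn_toLp.trans (hμ.koopman_congr_ae hd.pos h)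

theorem norm_koopmanLp_apply_le [HasOuterApproxClosed X] (hμ : F.IsInvariant d μ)
    (hd : F.IsTopologicalDegree d) (q : ℝ≥0∞) [Fact (1 ≤ q)] (hq : q ≠ ⊤) (φ : Lp 𝕜 q μ) :
    ‖koopmanLp hμ hd q hq φ‖ ≤ ‖φ‖ := by
  simpa using (koopmanLp (𝕜 := 𝕜) hμ hd q hq).le_of_opNorm_le
    (LinearMap.mkContinuous_norm_le _ zero_le_one _) φ

end Koopman

end HolomorphicCorrespondence

theorem proposition2 {k : ℕ} {X : Type*} [TopologicalSpace X] [T2Space X] [CompactSpace X]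
    [ConnectedSpace X] [ChartedSpace (EuclideanSpace ℂ (Fin k)) X]
    [IsManifold 𝓘(ℂ, EuclideanSpace ℂ (Fin k)) ω X] [MeasurableSpace X] [BorelSpace X]
    {𝕜 : Type*} [RCLike 𝕜]
    (F : HolomorphicCorrespondence k X) (d : ℕ) (hd : F.IsTopologicalDegree d)
    (μ : Measure X) [IsProbabilityMeasure μ] (hμ : F.IsInvariant d μ)
    (q : ℝ≥0∞) [Fact (1 ≤ q)] (hq : q ≠ ⊤) :
    ∃ U : Lp 𝕜 q μ →L[𝕜] Lp 𝕜 q μ,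
      (∀ (φ : Lp 𝕜 q μ) (f : X → 𝕜), φ =ᵐ[μ] f → U φ =ᵐ[μ] F.koopman d f) ∧
        ∀ φ : Lp 𝕜 q μ, ‖U φ‖ ≤ ‖φ‖ := by
  -- A compact Hausdorff manifold is second countable, hence metrizable; this supplies
  -- `HasOuterApproxClosed X`.
  have : SecondCountableTopology X :=
    ChartedSpace.secondCountable_of_sigmaCompact (EuclideanSpace ℂ (Fin k)) X
  have : TopologicalSpace.MetrizableSpace X :=
    TopologicalSpace.metrizableSpace_of_t3_secondCountable X
  exact ⟨HolomorphicCorrespondence.koopmanLp hμ hd q hq,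
    fun φ _ h => HolomorphicCorrespondence.koopmanLp_ae_eq hμ hd q hq φ h,
    HolomorphicCorrespondence.norm_koopmanLp_apply_le hμ hd q hq⟩
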